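/- Let $\mathbb{D}$ be the open unit disc and let $m$ be normalised Lebesgue measure on the unit circle $\partial\mathbb{D}$. An analytic map $g\colon\mathbb{D}\to\mathbb{D}$ is called inner if the radial limit $\hat g(\xi)=\lim_{r\nearrow 1} g(r\xi)$ exists and has modulus one for $m$-almost every $\xi\in\partial\mathbb{D}$; then $\hat g$ is a self-map of $\partial\mathbb{D}$ defined $m$-almost everywhere. Let $g_n\colon\mathbb{D}\to\mathbb{D}$, $n\ge 1$, be inner functions with $g_n(0)=0$, put $G_n = g_n\circ\cdots\circ g_1$ for $n\ge 1$ (these are again inner functions), and let $\widehat G_n$ be the boundary map of $G_n$. Then the sequence $\{\widehat G_n\}_{n\ge 1}$ is mixing in the usual sense, that is, \[ m\bigl(A\cap \widehat G_n^{-1}(B)\bigr)\to m(A)\,m(B)\quad\text{as } n\to\infty \] for all measurable sets $A,B\subset\partial\mathbb{D}$, if and only if $\{g_n\}_{n\ge 1}$ is contracting, that is, $G_n\to 0$ uniformly on compact subsets of $\mathbb{D}$ as $n\to\infty$. -/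

import Mathlib

open Filter Topology MeasureTheory

namespace InnerDynamics

/-- The Borel `σ`-algebra of the unit circle `∂𝔻`. -/
noncomputable instance instMeasurableSpaceCircle : MeasurableSpace Circle := borel Circle

instance instBorelSpaceCircle : BorelSpace Circle := ⟨rfl⟩

/-- Normalised Lebesgue measure `dθ / 2π` on the unit circle. -/
noncomputable def circleMeasure : Measure Circle :=
  (ENNReal.ofReal (2 * Real.pi))⁻¹ •
    (volume.restrict (Set.Ioc (0 : ℝ) (2 * Real.pi))).map Circle.exp

instance instIsProbabilityMeasureCircle : IsProbabilityMeasure circleMeasure := by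
  constructor
  have h : (0 : ℝ) < 2 * Real.pi := by positivity
  rw [circleMeasure, Measure.smul_apply,
    Measure.map_apply Circle.exp.continuous.measurable MeasurableSet.univ]
  simp only [Set.preimage_univ, Measure.restrict_apply_univ, Real.volume_Ioc, sub_zero,
    smul_eq_mul]
  exact ENNReal.inv_mul_cancel (ENNReal.ofReal_pos.mpr h).ne' ENNReal.ofReal_ne_top

/-- `η` is the radial limit of `g` at the boundary point `ξ`: `g (r ξ) → η` as `r ↗ 1`. -/
def HasRadialLimit (g : ℂ → ℂ) (ξ η : Circle) : Prop :=
  Tendsto (fun r : ℝ => g ((r : ℂ) * (ξ : ℂ))) (𝓝[<] (1 : ℝ)) (𝓝 (η : ℂ))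

/-- `g` is an inner function: an analytic self-map of the open unit disc (only the values of `g`
on the disc matter) whose radial limit exists and has modulus one at almost every point of the
unit circle. -/
structure IsInner (g : ℂ → ℂ) : Prop where
  differentiableOn : DifferentiableOn ℂ g (Metric.ball 0 1)
  mapsTo : Set.MapsTo g (Metric.ball 0 1) (Metric.ball 0 1)
  radialLimit : ∀ᵐ ξ ∂circleMeasure, ∃ η : Circle, HasRadialLimit g ξ η

open Classical in
/-- The boundary self-map `ĝ` of the unit circle, `ĝ ξ = lim_{r ↗ 1} g (r ξ)`. At the points where
no radial limit of modulus one exists (a null set if `g` is inner) it has the arbitrary value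
`1`. -/
noncomputable def boundaryMap (g : ℂ → ℂ) (ξ : Circle) : Circle :=
  if h : ∃ η : Circle, HasRadialLimit g ξ η then h.choose else 1

/-- The compositions `G n = g n ∘ ⋯ ∘ g 1` (with `G 0 = id`; the entry `g 0` is not used). -/
def composition (g : ℕ → ℂ → ℂ) : ℕ → ℂ → ℂ
  | 0 => id
  | n + 1 => g (n + 1) ∘ composition g n

/-- The sequence `g` is contracting: `G n → 0` uniformly on compact subsets of the unit disc. -/
def IsContracting (g : ℕ → ℂ → ℂ) : Prop :=
  ∀ K : Set ℂ, IsCompact K → K ⊆ Metric.ball 0 1 →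
    TendstoUniformlyOn (composition g) (fun _ => 0) atTop K

/-- The sequence `T` of self-maps of `X` is mixing in the usual sense with respect to `μ`. -/
def IsMixingUsual {X : Type*} [MeasurableSpace X] (μ : Measure X) (T : ℕ → X → X) : Prop :=
  ∀ A B : Set X, MeasurableSet A → MeasurableSet B →
    Tendsto (fun n => μ (A ∩ T n ⁻¹' B)) atTop (𝓝 (μ A * μ B))

end InnerDynamics

/-!
Write `m` for `circleMeasure`, `ĝ` for `boundaryMap g` and `G n` for `composition g n`.

*Decay of correlations.* The boundary map of an inner function fixing the origin preserves `m`,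
since `∫ ĝ ^ n dm = g 0 ^ n = 0` for `n ≥ 1` (`map_boundaryMap`). For a sequence of
measure-preserving maps, the convergence `∫ conj u * (v ∘ T n) → (∫ conj u) (∫ v)` propagates from a
family with dense span in `L²` to all of `L²`, because the Koopman operators are uniformly bounded
(`tendsto_correlation_of_dense`). Both the indicator functions and the monomials `ξ ^ k` span dense
subspaces, so mixing is equivalent to `∫ ξ ^ k * (Ĝ n) ^ j dm → 0` for all integers `k` and all
`j ≥ 1` (`isMixingUsual_circle_iff`).

*Taylor coefficients.* By Cauchy's theorem and dominated convergence, these integrals can be moved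
to the circle of radius `1 / 2` (`integral_zpow_mul_radialLimit`), where they tend to zero if
`G n → 0` uniformly there. Conversely, for `j = 1` and `k ≤ 0` they are the Taylor coefficients of
`G n`. These are bounded by one, so if each of them tends to zero then `G n → 0` uniformly on
compact sets.

*The compositions are inner.* Radial limits of `f ∘ g` exist by Fatou's theorem
(`ae_exists_radialLimit`), and `IsInner.comp` identifies them with `f̂ ∘ ĝ` by comparing Fourier
coefficients. For Fatou's theorem, a primitive `H` of a bounded analytic function is Lipschitz, so
it extends to the closed disc and is differentiable almost everywhere along the circle by
Rademacher's theorem. At such a point `ξ₀`, subtracting the first order expansion of `H` leaves a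
function `E` with `E ξ = o(ξ - ξ₀)`. A Cauchy formula for `deriv E` whose kernel is at most twice the
Poisson kernel divided by `‖ξ - z‖` shows that `deriv E` tends to zero radially at `ξ₀`
(`tendsto_deriv_of_isLittleO`).
-/

open scoped ComplexConjugate

namespace InnerDynamics

/-! ### Integration over the circle -/

lemma continuous_circle_coe : Continuous fun ξ : Circle => (ξ : ℂ) := continuous_subtype_val

lemma integral_circleMeasure {φ : Circle → ℂ} (hφ : Continuous φ) :
    ∫ ξ, φ ξ ∂circleMeasure =
      (2 * Real.pi : ℂ)⁻¹ * ∫ θ in (0 : ℝ)..2 * Real.pi, φ (Circle.exp θ) := by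
  have h2 : (0 : ℝ) ≤ 2 * Real.pi := by positivity
  rw [circleMeasure, integral_smul_measure,
    integral_map Circle.exp.continuous.aemeasurable hφ.aestronglyMeasurable,
    intervalIntegral.integral_of_le h2, ENNReal.toReal_inv, ENNReal.toReal_ofReal h2,
    Complex.real_smul]
  push_cast
  rfl

lemma continuous_comp_real_mul_circle {F : ℂ → ℂ} {r : ℝ} (hr : 0 ≤ r)
    (hF : ContinuousOn F (Metric.sphere 0 r)) :
    Continuous fun ξ : Circle => F (r * ξ) := by
  refine hF.comp_continuous (by fun_prop) fun ξ => ?_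
  simp [abs_of_nonneg hr, Circle.norm_coe]

lemma circleIntegral_inv_mul_eq {F : ℂ → ℂ} {r : ℝ} (hr : 0 < r)
    (hF : ContinuousOn F (Metric.sphere 0 r)) :
    ∮ z in C(0, r), z⁻¹ * F z =
      2 * Real.pi * Complex.I * ∫ ξ : Circle, F (r * ξ) ∂circleMeasure := by
  have hr' : (r : ℂ) ≠ 0 := by exact_mod_cast hr.ne'
  have hpi : (Real.pi : ℂ) ≠ 0 := by exact_mod_cast Real.pi_ne_zero
  rw [integral_circleMeasure (continuous_comp_real_mul_circle hr.le hF), circleIntegral,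
    show (2 * Real.pi * Complex.I : ℂ) * ((2 * Real.pi : ℂ)⁻¹ *
      ∫ θ in (0 : ℝ)..2 * Real.pi, F (r * (Circle.exp θ : ℂ))) =
      Complex.I * ∫ θ in (0 : ℝ)..2 * Real.pi, F (r * (Circle.exp θ : ℂ)) by field_simp,
    ← intervalIntegral.integral_const_mul]
  refine intervalIntegral.integral_congr fun θ _ => ?_
  simp only [deriv_circleMap, circleMap, zero_add, Circle.coe_exp, smul_eq_mul]
  have := Complex.exp_ne_zero (θ * Complex.I)
  field_simp

/-- The measure on the circle is carried by the angle: a property holding at almost every angle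
holds at almost every point of the circle, without any measurability assumption. -/
lemma ae_circleMeasure_of_ae_exp {P : Circle → Prop}
    (h : ∀ᵐ θ : ℝ, P (Circle.exp θ)) : ∀ᵐ ξ ∂circleMeasure, P ξ := by
  obtain ⟨N, hN, hNm, hN0⟩ := exists_measurable_superset_of_null (ae_iff.1 h)
  have hT : Measurable fun ξ : Circle => Complex.arg ξ :=
    Complex.measurable_arg.comp continuous_circle_coe.measurable
  refine ae_iff.2 (measure_mono_null (t := (fun ξ : Circle => Complex.arg ξ) ⁻¹' N)
    (fun ξ hξ => hN (by simpa [Circle.exp_arg] using hξ)) ?_)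
  rw [circleMeasure, Measure.smul_apply,
    Measure.map_apply Circle.exp.continuous.measurable (hT hNm)]
  refine smul_eq_zero_of_right _ (le_antisymm ((Measure.restrict_apply
    (Circle.exp.continuous.measurable (hT hNm))).trans_le ?_) zero_le)
  have h2 : volume ((fun x : ℝ => -(2 * Real.pi) + x) ⁻¹' N) = 0 := by
    rw [measure_preimage_add, hN0]
  rw [← measure_union_null hN0 h2]
  -- on `(0, 2π]` the principal argument of `exp θ` is `θ` or `θ - 2π`
  refine measure_mono fun θ ⟨hθ, hθ0, hθ1⟩ => ?_
  simp only [Set.mem_preimage] at hθ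
  rcases le_or_gt θ Real.pi with hle | hgt
  · left
    rwa [Circle.arg_exp (by linarith) hle] at hθ
  · right
    have : Circle.exp θ = Circle.exp (-(2 * Real.pi) + θ) := by
      rw [neg_add_eq_sub, Circle.exp_sub_two_pi]
    rwa [this, Circle.arg_exp (by linarith) (by linarith)] at hθ

/-! ### Fatou's theorem -/

lemma norm_one_sub_conj_mul (z : ℂ) (ξ : Circle) : ‖1 - conj z * (ξ : ℂ)‖ = ‖(ξ : ℂ) - z‖ := by
  rw [← Complex.norm_conj ((ξ : ℂ) - z), map_sub]
  have : (1 - conj z * (ξ : ℂ)) = ξ * (conj (ξ : ℂ) - conj z) := by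
    have : (ξ : ℂ) * conj (ξ : ℂ) = 1 := by simp [Complex.mul_conj, Circle.normSq_coe]
    linear_combination -this
  rw [this, norm_mul, Circle.norm_coe, one_mul]

lemma circle_sub_ne_zero {z : ℂ} (hz : ‖z‖ < 1) (ξ : Circle) : (ξ : ℂ) - z ≠ 0 := by
  intro h
  have : ‖(ξ : ℂ)‖ = ‖z‖ := by rw [sub_eq_zero.1 h]
  rw [Circle.norm_coe] at this
  linarith

lemma one_sub_conj_mul_ne_zero {z w : ℂ} (hz : ‖z‖ < 1) (hw : ‖w‖ ≤ 1) : 1 - conj z * w ≠ 0 := by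
  intro h
  have : ‖conj z * w‖ = 1 := by rw [← sub_eq_zero.1 h, norm_one]
  rw [norm_mul, Complex.norm_conj] at this
  nlinarith [norm_nonneg z, norm_nonneg w]

lemma diffContOnCl_inv_one_sub_conj_mul {z : ℂ} (hz : ‖z‖ < 1) :
    DiffContOnCl ℂ (fun w => (1 - conj z * w)⁻¹) (Metric.ball 0 1) := by
  refine DifferentiableOn.diffContOnCl ?_
  rw [closure_ball _ one_ne_zero]
  refine DifferentiableOn.inv (by fun_prop) fun w hw => one_sub_conj_mul_ne_zero hz ?_
  simpa using hw

/-- The Poisson kernel has total mass one. -/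
lemma integral_inv_norm_sub_sq {z : ℂ} (hz : ‖z‖ < 1) :
    ∫ ξ : Circle, (‖(ξ : ℂ) - z‖ ^ 2)⁻¹ ∂circleMeasure = (1 - ‖z‖ ^ 2)⁻¹ := by
  have hz' : z ∈ Metric.ball (0 : ℂ) 1 := by simpa using hz
  have hcauchy := (diffContOnCl_inv_one_sub_conj_mul hz).circleIntegral_sub_inv_smul hz'
  have hF : ContinuousOn (fun w => w * ((w - z)⁻¹ * (1 - conj z * w)⁻¹))
      (Metric.sphere (0 : ℂ) 1) := by
    refine ContinuousOn.mul (by fun_prop) (ContinuousOn.mul (ContinuousOn.inv₀ (by fun_prop) ?_)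
      (ContinuousOn.inv₀ (by fun_prop) ?_))
    · rintro w hw
      exact circle_sub_ne_zero hz ⟨w, hw⟩
    · rintro w hw
      exact one_sub_conj_mul_ne_zero hz (by simpa using (mem_sphere_zero_iff_norm.1 hw).le)
  have h := circleIntegral_inv_mul_eq one_pos hF
  have e : ∮ w in C(0, 1), w⁻¹ * (w * ((w - z)⁻¹ * (1 - conj z * w)⁻¹)) =
      ∮ w in C(0, 1), (w - z)⁻¹ • (1 - conj z * w)⁻¹ := by
    refine circleIntegral.integral_congr zero_le_one fun w hw => ?_
    have hw0 : w ≠ 0 := by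
      rintro rfl
      simp at hw
    simp [hw0]
  rw [e, hcauchy, smul_eq_mul] at h
  have h' := mul_left_cancel₀ Complex.two_pi_I_ne_zero h
  have hr : ∀ ξ : Circle, ((1 : ℝ) : ℂ) * ξ * ((((1 : ℝ) : ℂ) * ξ - z)⁻¹ *
      (1 - conj z * (((1 : ℝ) : ℂ) * ξ))⁻¹) = (((‖(ξ : ℂ) - z‖ ^ 2)⁻¹ : ℝ) : ℂ) := by
    intro ξ
    have h1 : (ξ : ℂ) * conj (ξ : ℂ) = 1 := by simp [Complex.mul_conj, Circle.normSq_coe]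
    have h2 := circle_sub_ne_zero hz ξ
    have h3 := one_sub_conj_mul_ne_zero hz (w := ξ) (Circle.norm_coe ξ).le
    have h4 : (ξ : ℂ) * conj ((ξ : ℂ) - z) = 1 - conj z * ξ := by
      rw [map_sub]
      linear_combination h1
    push_cast
    simp only [one_mul]
    rw [← Complex.mul_conj', ← h4]
    have h5 : conj ((ξ : ℂ) - z) ≠ 0 := (map_ne_zero _).2 h2
    have h6 := Circle.coe_ne_zero ξ
    field_simp
  simp_rw [hr] at h'
  rw [integral_complex_ofReal, mul_comm (conj z), Complex.mul_conj'] at h'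
  exact_mod_cast h'.symm

/-- A Cauchy formula for the derivative whose kernel is symmetrised by the reflected pole
`1 / conj z`. The extra term integrates to zero and makes the kernel small near the circle. -/
lemma deriv_eq_integral {E : ℂ → ℂ} (hE : DiffContOnCl ℂ E (Metric.ball 0 1)) {z : ℂ}
    (hz : ‖z‖ < 1) :
    deriv E z = ∫ ξ : Circle, E ξ * ξ *
      ((((ξ : ℂ) - z) ^ 2)⁻¹ - conj z ^ 2 * ((1 - conj z * ξ) ^ 2)⁻¹) ∂circleMeasure := by
  have hz' : z ∈ Metric.ball (0 : ℂ) 1 := by simpa using hz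
  have hsub : ∀ w ∈ Metric.sphere (0 : ℂ) 1, w - z ≠ 0 := fun w hw => circle_sub_ne_zero hz ⟨w, hw⟩
  have hEc : ContinuousOn E (Metric.closedBall 0 1) := hE.continuousOn_ball
  have hEs : ContinuousOn E (Metric.sphere 0 1) := hEc.mono Metric.sphere_subset_closedBall
  have hEd : DifferentiableAt ℂ E z := hE.differentiableAt Metric.isOpen_ball hz'
  -- the pole inside the disc
  have h1 : ∮ w in C(0, 1), E w * ((w - z) ^ 2)⁻¹ = 2 * Real.pi * Complex.I * deriv E z := by
    have hD : (∮ w in C(0, 1), (w - z)⁻¹ • dslope E z w) =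
        (2 * Real.pi * Complex.I) • dslope E z z :=
      Complex.circleIntegral_sub_inv_smul_of_differentiable_on_off_countable
        (Set.countable_singleton z) hz'
        ((continuousOn_dslope (Metric.closedBall_mem_nhds_of_mem hz')).2 ⟨hEc, hEd⟩)
        fun w hw => (differentiableAt_dslope_of_ne hw.2).2
          (hE.differentiableAt Metric.isOpen_ball hw.1)
    have h0 : ∮ w in C(0, 1), (w - z) ^ (-2 : ℤ) = 0 :=
      circleIntegral.integral_sub_zpow_of_ne (by norm_num) _ _ _
    have hi1 : CircleIntegrable (fun w => (w - z)⁻¹ • dslope E z w) 0 1 := by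
      refine ContinuousOn.circleIntegrable zero_le_one (ContinuousOn.smul
        (ContinuousOn.inv₀ (by fun_prop) hsub) ?_)
      exact ((continuousOn_dslope (Metric.closedBall_mem_nhds_of_mem hz')).2 ⟨hEc, hEd⟩).mono
        Metric.sphere_subset_closedBall
    have hi2 : CircleIntegrable (fun w => E z * (w - z) ^ (-2 : ℤ)) 0 1 := by
      refine ContinuousOn.circleIntegrable zero_le_one (ContinuousOn.mul continuousOn_const
        (ContinuousOn.zpow₀ (by fun_prop) _ fun w hw => Or.inl (hsub w hw)))
    have h2 := circleIntegral.integral_add hi1 hi2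
    rw [hD, circleIntegral.integral_const_mul, h0, mul_zero, add_zero, dslope_same,
      smul_eq_mul] at h2
    rw [← h2]
    refine circleIntegral.integral_congr zero_le_one fun w hw => ?_
    have hw' := hsub w hw
    have hne : w ≠ z := sub_ne_zero.1 hw'
    simp only [dslope_of_ne _ hne, slope_def_field, smul_eq_mul, zpow_neg]
    rw [show ((2 : ℤ)) = ((2 : ℕ) : ℤ) from rfl, zpow_natCast]
    field_simp
    ring
  -- the reflected pole lies outside
  have hR := diffContOnCl_inv_one_sub_conj_mul hz
  have hG : DiffContOnCl ℂ (fun w => E w * (conj z ^ 2 * ((1 - conj z * w) ^ 2)⁻¹))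
      (Metric.ball 0 1) := by
    have := hE.smul ((hR.smul hR).const_smul (conj z ^ 2))
    convert this using 2 with w
    simp [pow_two]
  have h2 := hG.circleIntegral_eq_zero zero_le_one
  have hF : ContinuousOn (fun w => E w * w *
      (((w - z) ^ 2)⁻¹ - conj z ^ 2 * ((1 - conj z * w) ^ 2)⁻¹)) (Metric.sphere (0 : ℂ) 1) := by
    refine (hEs.mul continuousOn_id).mul (ContinuousOn.sub (ContinuousOn.inv₀ (by fun_prop) ?_)
      (continuousOn_const.mul (ContinuousOn.inv₀ (by fun_prop) ?_)))
    · exact fun w hw => pow_ne_zero 2 (hsub w hw)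
    · exact fun w hw => pow_ne_zero 2
        (one_sub_conj_mul_ne_zero hz (mem_sphere_zero_iff_norm.1 hw).le)
  have h := circleIntegral_inv_mul_eq one_pos hF
  have hi1 : CircleIntegrable (fun w => E w * ((w - z) ^ 2)⁻¹) 0 1 :=
    ContinuousOn.circleIntegrable zero_le_one (hEs.mul (ContinuousOn.inv₀ (by fun_prop)
      fun w hw => pow_ne_zero 2 (hsub w hw)))
  have hi2 : CircleIntegrable (fun w => E w * (conj z ^ 2 * ((1 - conj z * w) ^ 2)⁻¹)) 0 1 :=
    ContinuousOn.circleIntegrable zero_le_one (hG.continuousOn_ball.mono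
      Metric.sphere_subset_closedBall)
  have e : ∮ w in C(0, 1), w⁻¹ * (E w * w *
      (((w - z) ^ 2)⁻¹ - conj z ^ 2 * ((1 - conj z * w) ^ 2)⁻¹)) =
      ∮ w in C(0, 1), (E w * ((w - z) ^ 2)⁻¹ - E w * (conj z ^ 2 * ((1 - conj z * w) ^ 2)⁻¹)) := by
    refine circleIntegral.integral_congr zero_le_one fun w hw => ?_
    have hw0 : w ≠ 0 := by
      rintro rfl
      simp at hw
    field_simp
  rw [e, circleIntegral.integral_sub hi1 hi2, h1, h2, sub_zero] at h
  simpa using mul_left_cancel₀ Complex.two_pi_I_ne_zero h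

/-- On the circle the symmetrised Cauchy kernel is at most the Poisson kernel times
`2 / ‖ξ - z‖`. -/
lemma norm_deriv_le_integral {E : ℂ → ℂ} (hE : DiffContOnCl ℂ E (Metric.ball 0 1)) {z : ℂ}
    (hz : ‖z‖ < 1) :
    ‖deriv E z‖ ≤ ∫ ξ : Circle, 2 * (1 - ‖z‖ ^ 2) * ‖E ξ‖ / ‖(ξ : ℂ) - z‖ ^ 3 ∂circleMeasure := by
  rw [deriv_eq_integral hE hz]
  have hEc : Continuous fun ξ : Circle => E ξ := hE.continuousOn_ball.comp_continuous
    continuous_circle_coe fun ξ => by simp [Circle.norm_coe]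
  have hc := continuous_circle_coe
  refine norm_integral_le_of_norm_le ?_ (ae_of_all _ fun ξ => ?_)
  · refine Continuous.integrable_of_hasCompactSupport ?_ (HasCompactSupport.of_compactSpace _)
    refine Continuous.div (continuous_const.mul hEc.norm) (by fun_prop) fun ξ => ?_
    exact pow_ne_zero 3 (norm_ne_zero_iff.2 (circle_sub_ne_zero hz ξ))
  · have ha := circle_sub_ne_zero hz ξ
    have hb := one_sub_conj_mul_ne_zero hz (w := ξ) (Circle.norm_coe ξ).le
    have hab := norm_one_sub_conj_mul z ξ
    set a : ℂ := (ξ : ℂ) - z with ha_def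
    set b : ℂ := 1 - conj z * (ξ : ℂ) with hb_def
    have hza : conj z * a = conj z * (ξ : ℂ) - ‖z‖ ^ 2 := by
      rw [ha_def, ← Complex.mul_conj']
      ring
    -- the difference of squares has the small factor `b + conj z * a = 1 - ‖z‖ ^ 2`
    have hk : (a ^ 2)⁻¹ - conj z ^ 2 * (b ^ 2)⁻¹ =
        (b - conj z * a) * (1 - ‖z‖ ^ 2 : ℝ) / (a ^ 2 * b ^ 2) := by
      have : ((1 - ‖z‖ ^ 2 : ℝ) : ℂ) = b + conj z * a := by
        rw [hza, hb_def]
        push_cast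
        ring
      rw [this]
      field_simp
      ring
    have ha' : 0 < ‖a‖ := norm_pos_iff.2 ha
    have hz2 : 0 ≤ 1 - ‖z‖ ^ 2 := by nlinarith [norm_nonneg z]
    have hn : ‖b - conj z * a‖ ≤ 2 * ‖a‖ := by
      refine (norm_sub_le _ _).trans ?_
      rw [norm_mul, Complex.norm_conj, hab]
      nlinarith
    rw [hk, norm_mul, norm_mul, Circle.norm_coe, mul_one, norm_div, norm_mul, norm_mul, norm_pow,
      norm_pow, hab, Complex.norm_real, Real.norm_of_nonneg hz2]
    calc ‖E ξ‖ * (‖b - conj z * a‖ * (1 - ‖z‖ ^ 2) / (‖a‖ ^ 2 * ‖a‖ ^ 2))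
        ≤ ‖E ξ‖ * (2 * ‖a‖ * (1 - ‖z‖ ^ 2) / (‖a‖ ^ 2 * ‖a‖ ^ 2)) := by gcongr
      _ = _ := by field_simp

/-- The linear part of the bound on `E` is integrated against the Poisson kernel, using
`‖ξ - ξ₀‖ ≤ 2 * ‖ξ - r * ξ₀‖`; the cubic part cancels the kernel altogether. -/
lemma norm_deriv_le {E : ℂ → ℂ} (hE : DiffContOnCl ℂ E (Metric.ball 0 1)) {ξ₀ : Circle}
    {ε C : ℝ} (hε : 0 ≤ ε) (hC : 0 ≤ C)
    (h : ∀ ξ : Circle, ‖E ξ‖ ≤ ε * ‖(ξ : ℂ) - ξ₀‖ + C * ‖(ξ : ℂ) - ξ₀‖ ^ 3) {r : ℝ} (hr0 : 0 ≤ r)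
    (hr : r < 1) :
    ‖deriv E (r * ξ₀)‖ ≤ 4 * ε + 16 * C * (1 - r ^ 2) := by
  have hnz : ‖(r * ξ₀ : ℂ)‖ = r := by simp [Circle.norm_coe, abs_of_nonneg hr0]
  have hz : ‖(r * ξ₀ : ℂ)‖ < 1 := by rwa [hnz]
  have hc := continuous_circle_coe
  have hr2 : 0 < 1 - r ^ 2 := by nlinarith
  have hint : Integrable (fun ξ : Circle => (‖(ξ : ℂ) - r * ξ₀‖ ^ 2)⁻¹) circleMeasure := by
    refine Continuous.integrable_of_hasCompactSupport ?_ (HasCompactSupport.of_compactSpace _)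
    refine Continuous.inv₀ (by fun_prop) fun ξ => ?_
    exact pow_ne_zero 2 (norm_ne_zero_iff.2 (circle_sub_ne_zero hz ξ))
  calc ‖deriv E (r * ξ₀)‖
      ≤ ∫ ξ : Circle, 2 * (1 - r ^ 2) * ‖E ξ‖ / ‖(ξ : ℂ) - r * ξ₀‖ ^ 3 ∂circleMeasure := by
        simpa only [hnz] using norm_deriv_le_integral hE hz
    _ ≤ ∫ ξ : Circle, (4 * ε * (1 - r ^ 2) * (‖(ξ : ℂ) - r * ξ₀‖ ^ 2)⁻¹ + 16 * C * (1 - r ^ 2))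
          ∂circleMeasure := by
        refine integral_mono_of_nonneg (ae_of_all _ fun ξ => by positivity)
          ((hint.const_mul _).add (integrable_const _)) (ae_of_all _ fun ξ => ?_)
        have ha : 0 < ‖(ξ : ℂ) - r * ξ₀‖ := norm_pos_iff.2 (circle_sub_ne_zero hz ξ)
        have hd : ‖(ξ : ℂ) - ξ₀‖ ≤ 2 * ‖(ξ : ℂ) - r * ξ₀‖ := by
          have h1 : ‖(r * ξ₀ : ℂ) - ξ₀‖ = 1 - r := by
            rw [show (r * ξ₀ : ℂ) - ξ₀ = ((r - 1 : ℝ) : ℂ) * ξ₀ by push_cast; ring, norm_mul,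
              Circle.norm_coe, mul_one, Complex.norm_real, Real.norm_eq_abs, abs_sub_comm,
              abs_of_pos (by linarith)]
          have h2 : 1 - r ≤ ‖(ξ : ℂ) - r * ξ₀‖ := by
            have := norm_sub_norm_le (ξ : ℂ) (r * ξ₀)
            rwa [Circle.norm_coe, hnz] at this
          linarith [norm_sub_le_norm_sub_add_norm_sub (ξ : ℂ) (r * ξ₀) ξ₀]
        have hE' := h ξ
        set a := ‖(ξ : ℂ) - r * ξ₀‖
        have h3 : ‖E ξ‖ ≤ ε * (2 * a) + C * (2 * a) ^ 3 := hE'.trans (by gcongr)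
        calc 2 * (1 - r ^ 2) * ‖E ξ‖ / a ^ 3
            ≤ 2 * (1 - r ^ 2) * (ε * (2 * a) + C * (2 * a) ^ 3) / a ^ 3 := by gcongr
          _ = 4 * ε * (1 - r ^ 2) * (a ^ 2)⁻¹ + 16 * C * (1 - r ^ 2) := by
            field_simp
            ring
    _ = 4 * ε + 16 * C * (1 - r ^ 2) := by
        rw [integral_add (hint.const_mul _) (integrable_const _), integral_const_mul,
          integral_inv_norm_sub_sq hz, hnz]
        simp
        field_simp

lemma tendsto_deriv_of_isLittleO {E : ℂ → ℂ} (hE : DiffContOnCl ℂ E (Metric.ball 0 1))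
    {ξ₀ : Circle} (h : (fun ξ : Circle => E ξ) =o[𝓝 ξ₀] fun ξ : Circle => (ξ : ℂ) - ξ₀) :
    Tendsto (fun r : ℝ => deriv E (r * ξ₀)) (𝓝[<] 1) (𝓝 0) := by
  have hEc : Continuous fun ξ : Circle => E ξ := hE.continuousOn_ball.comp_continuous
    continuous_circle_coe fun ξ => by simp [Circle.norm_coe]
  obtain ⟨M, hM⟩ := isCompact_univ.exists_bound_of_continuousOn hEc.continuousOn
  have hM0 : 0 ≤ M := (norm_nonneg _).trans (hM 1 trivial)
  refine Metric.tendsto_nhds.2 fun ε hε => ?_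
  obtain ⟨δ, hδ, hball⟩ := Metric.eventually_nhds_iff.1
    (Asymptotics.isLittleO_iff.1 h (show 0 < ε / 8 by positivity))
  -- away from `ξ₀` the function is merely bounded, which the cubic term absorbs
  have hbound : ∀ ξ : Circle,
      ‖E ξ‖ ≤ ε / 8 * ‖(ξ : ℂ) - ξ₀‖ + M / δ ^ 3 * ‖(ξ : ℂ) - ξ₀‖ ^ 3 := by
    intro ξ
    rcases lt_or_ge (dist ξ ξ₀) δ with hlt | hge
    · exact (hball hlt).trans (le_add_of_nonneg_right (by positivity))
    · have hge' : δ ≤ ‖(ξ : ℂ) - ξ₀‖ := by rwa [← dist_eq_norm]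
      refine (hM ξ trivial).trans (le_add_of_nonneg_of_le (by positivity) ?_)
      calc M = M / δ ^ 3 * δ ^ 3 := by field_simp
        _ ≤ _ := by gcongr
  have hlim : Tendsto (fun r : ℝ => 4 * (ε / 8) + 16 * (M / δ ^ 3) * (1 - r ^ 2)) (𝓝[<] 1)
      (𝓝 (4 * (ε / 8) + 16 * (M / δ ^ 3) * (1 - 1 ^ 2))) :=
    tendsto_nhdsWithin_of_tendsto_nhds (Continuous.tendsto (by fun_prop) 1)
  have hlt : 4 * (ε / 8) + 16 * (M / δ ^ 3) * (1 - 1 ^ 2) < ε := by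
    norm_num
    linarith
  filter_upwards [hlim.eventually_lt_const hlt, Ioo_mem_nhdsLT (show (0 : ℝ) < 1 by norm_num)]
    with r hr hr01
  rw [dist_zero_right]
  exact (norm_deriv_le hE (by positivity) (by positivity) hbound hr01.1.le hr01.2).trans_lt hr

lemma norm_arg_div_le (ξ η : Circle) :
    |Complex.arg ((ξ / η : Circle) : ℂ)| ≤ Real.pi / 2 * ‖(ξ : ℂ) - η‖ := by
  have h := (Complex.norm_sub_mem_Icc_angle (Circle.norm_coe ξ) (Circle.norm_coe η)).1
  rw [Complex.angle_eq_abs_arg (Circle.coe_ne_zero _) (Circle.coe_ne_zero _)] at h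
  rw [Circle.coe_div]
  have hpi := Real.pi_pos
  calc _ = Real.pi / 2 * (2 / Real.pi * |((ξ : ℂ) / η).arg|) := by field_simp
    _ ≤ _ := by gcongr

lemma hasDerivAt_coe_circle_exp (θ : ℝ) :
    HasDerivAt (fun t : ℝ => (Circle.exp t : ℂ)) (Complex.I * Circle.exp θ) θ := by
  have := ((hasDerivAt_id θ).ofReal_comp.mul_const Complex.I).cexp
  simpa [mul_comm] using this

/-- Differentiability along the angle, restated as a first order expansion in the point of the
circle. -/
lemma isLittleO_circle_of_hasDerivAt {Φ : ℂ → ℂ} {θ : ℝ} {d : ℂ}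
    (h : HasDerivAt (fun t : ℝ => Φ (Circle.exp t)) d θ) :
    (fun ξ : Circle => Φ ξ - Φ (Circle.exp θ) -
        d / (Complex.I * Circle.exp θ) * ((ξ : ℂ) - Circle.exp θ)) =o[𝓝 (Circle.exp θ)]
      fun ξ : Circle => (ξ : ℂ) - Circle.exp θ := by
  set c := d / (Complex.I * Circle.exp θ) with hc
  have hexp := hasDerivAt_coe_circle_exp θ
  have hne : Complex.I * (Circle.exp θ : ℂ) ≠ 0 :=
    mul_ne_zero Complex.I_ne_zero (Circle.coe_ne_zero _)
  have hψ := (h.sub_const (Φ (Circle.exp θ))).sub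
    ((hexp.sub_const (Circle.exp θ : ℂ)).const_mul c)
  have h0 : d - c * (Complex.I * Circle.exp θ) = 0 := by
    rw [hc, div_mul_cancel₀ _ hne, sub_self]
  rw [h0] at hψ
  have ho := hasDerivAt_iff_isLittleO.1 hψ
  -- the angle of a point close to `exp θ`
  set τ : Circle → ℝ := fun ξ => θ + Complex.arg ((ξ / Circle.exp θ : Circle) : ℂ) with hτ
  have hτexp : ∀ ξ, Circle.exp (τ ξ) = ξ := fun ξ => by
    rw [hτ]
    simp only
    rw [Circle.exp_add, Circle.exp_arg, mul_div_cancel]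
  have hO : (fun ξ => τ ξ - θ) =O[𝓝 (Circle.exp θ)] fun ξ : Circle => (ξ : ℂ) - Circle.exp θ :=
    Asymptotics.IsBigO.of_bound (Real.pi / 2) (Eventually.of_forall fun ξ => by
      simpa [hτ] using norm_arg_div_le ξ (Circle.exp θ))
  have hτt : Tendsto τ (𝓝 (Circle.exp θ)) (𝓝 θ) := by
    have h1 : Tendsto (fun ξ : Circle => (ξ : ℂ) - Circle.exp θ) (𝓝 (Circle.exp θ)) (𝓝 0) := by
      have := (continuous_circle_coe.sub continuous_const).tendsto
        (f := fun ξ : Circle => (ξ : ℂ) - Circle.exp θ) (Circle.exp θ)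
      simpa using this
    have := (hO.trans_tendsto h1).add_const θ
    simpa using this
  have hfin := (ho.comp_tendsto hτt).trans_isBigO hO
  refine hfin.congr_left fun ξ => ?_
  simp only [Function.comp_apply, Pi.sub_apply, hτexp, smul_zero, sub_self, mul_zero, sub_zero]

/-- **Fatou's theorem**: a bounded analytic function on the disc has radial limits almost
everywhere. -/
theorem ae_exists_radialLimit {h : ℂ → ℂ} (hd : DifferentiableOn ℂ h (Metric.ball 0 1))
    (hb : ∀ z ∈ Metric.ball (0 : ℂ) 1, ‖h z‖ ≤ 1) :
    ∀ᵐ ξ : Circle ∂circleMeasure, ∃ l : ℂ,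
      Tendsto (fun r : ℝ => h ((r : ℂ) * (ξ : ℂ))) (𝓝[<] (1 : ℝ)) (𝓝 l) := by
  obtain ⟨H₀, hH₀⟩ := hd.isExactOn_ball
  have hlip : LipschitzOnWith 1 H₀ (Metric.ball 0 1) :=
    (convex_ball (0 : ℂ) 1).lipschitzOnWith_of_nnnorm_hasDerivWithin_le
      (fun z hz => (hH₀ z hz).hasDerivWithinAt) fun z hz => by exact_mod_cast hb z hz
  obtain ⟨H, hH, hEq⟩ := hlip.extend_finite_dimension
  have hHd : ∀ z ∈ Metric.ball (0 : ℂ) 1, HasDerivAt H (h z) z := fun z hz =>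
    (hH₀ z hz).congr_of_eventuallyEq (hEq.symm.eventuallyEq_of_mem (Metric.isOpen_ball.mem_nhds hz))
  have hexp : LipschitzWith 1 fun t : ℝ => (Circle.exp t : ℂ) :=
    lipschitzWith_of_nnnorm_deriv_le
      (fun t => (hasDerivAt_coe_circle_exp t).differentiableAt) fun t => by
        rw [(hasDerivAt_coe_circle_exp t).deriv, nnnorm_mul, Complex.nnnorm_I, one_mul,
          ← NNReal.coe_le_coe, coe_nnnorm, Circle.norm_coe, NNReal.coe_one]
  have hae := (hH.comp hexp).ae_differentiableAt (μ := volume)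
  refine ae_circleMeasure_of_ae_exp ?_
  filter_upwards [hae] with θ hθ
  have hlo := isLittleO_circle_of_hasDerivAt (Φ := H) hθ.hasDerivAt
  set c := deriv (H ∘ fun t : ℝ => (Circle.exp t : ℂ)) θ / (Complex.I * Circle.exp θ)
  set E : ℂ → ℂ := fun z => H z - H (Circle.exp θ) - c * (z - Circle.exp θ) with hE
  have hEd : ∀ z ∈ Metric.ball (0 : ℂ) 1, HasDerivAt E (h z - c) z := fun z hz => by
    have := ((hHd z hz).sub_const (H (Circle.exp θ))).sub
      (((hasDerivAt_id z).sub_const (Circle.exp θ : ℂ)).const_mul c)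
    rwa [mul_one] at this
  have hEcl : DiffContOnCl ℂ E (Metric.ball 0 1) :=
    ⟨fun z hz => (hEd z hz).differentiableAt.differentiableWithinAt, by
      have := hH.continuous
      exact Continuous.continuousOn (by fun_prop)⟩
  refine ⟨c, ?_⟩
  have hlim := (tendsto_deriv_of_isLittleO hEcl hlo).add_const c
  rw [zero_add] at hlim
  refine hlim.congr' ?_
  filter_upwards [Ioo_mem_nhdsLT (show (0 : ℝ) < 1 by norm_num)] with r hr
  rw [(hEd _ _).deriv, sub_add_cancel]
  simpa [Circle.norm_coe, abs_of_pos hr.1] using hr.2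

/-! ### Moments of boundary functions -/

lemma integral_real_mul_eq {h : ℂ → ℂ} (hd : DifferentiableOn ℂ h (Metric.ball 0 1)) {r : ℝ}
    (hr0 : 0 < r) (hr : r < 1) : ∫ ξ : Circle, h (r * ξ) ∂circleMeasure = h 0 := by
  have hsub : Metric.closedBall (0 : ℂ) r ⊆ Metric.ball 0 1 := Metric.closedBall_subset_ball hr
  have h1 := (hd.mono hsub).circleIntegral_sub_inv_smul (Metric.mem_ball_self hr0)
  have h2 := circleIntegral_inv_mul_eq hr0
    ((hd.continuousOn.mono hsub).mono Metric.sphere_subset_closedBall)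
  simp only [sub_zero, smul_eq_mul] at h1
  exact (mul_left_cancel₀ Complex.two_pi_I_ne_zero (h1.symm.trans h2)).symm

lemma continuousOn_zpow_mul {h : ℂ → ℂ} {s : Set ℂ} (hc : ContinuousOn h s) (hs : ∀ z ∈ s, z ≠ 0)
    (k : ℤ) : ContinuousOn (fun z => z ^ k * h z) s :=
  (continuousOn_id.zpow₀ k fun z hz => Or.inl (hs z hz)).mul hc

/-- The `k`-th moment of an analytic function over the circle of radius `r`, normalised by
`r ^ k`, does not depend on `r`; for `k ≤ 0` this is a Taylor coefficient. -/
lemma zpow_mul_integral_eq {h : ℂ → ℂ} (hd : DifferentiableOn ℂ h (Metric.ball 0 1)) (k : ℤ)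
    {r R : ℝ} (hr0 : 0 < r) (hrR : r ≤ R) (hR : R < 1) :
    (r : ℂ) ^ k * ∫ ξ : Circle, (ξ : ℂ) ^ k * h (r * ξ) ∂circleMeasure =
      (R : ℂ) ^ k * ∫ ξ : Circle, (ξ : ℂ) ^ k * h (R * ξ) ∂circleMeasure := by
  have key : ∀ s : ℝ, 0 < s → s < 1 →
      ∮ z in C(0, s), z⁻¹ * (z ^ k * h z) = 2 * Real.pi * Complex.I *
        ((s : ℂ) ^ k * ∫ ξ : Circle, (ξ : ℂ) ^ k * h (s * ξ) ∂circleMeasure) := by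
    intro s hs0 hs
    have hsub : Metric.sphere (0 : ℂ) s ⊆ Metric.ball 0 1 :=
      Metric.sphere_subset_closedBall.trans (Metric.closedBall_subset_ball hs)
    rw [circleIntegral_inv_mul_eq hs0 (continuousOn_zpow_mul (hd.continuousOn.mono hsub)
      (fun z hz => Metric.ne_of_mem_sphere hz hs0.ne') k)]
    congr 1
    rw [← integral_const_mul]
    simp only [mul_zpow, mul_assoc]
  have hann :=
    Complex.circleIntegral_sub_center_inv_smul_eq_of_differentiable_on_annulus_off_countable
    (f := fun z => z ^ k * h z) (c := 0) hr0 hrR Set.countable_empty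
    (continuousOn_zpow_mul (hd.continuousOn.mono (Set.sdiff_subset.trans
      (Metric.closedBall_subset_ball hR))) (fun z hz h0 => hz.2 (h0 ▸ Metric.mem_ball_self hr0)) k)
    (by
      rintro z ⟨⟨hz1, hz2⟩, -⟩
      refine DifferentiableAt.mul (differentiableAt_zpow.2 (Or.inl ?_)) (hd.differentiableAt
        (Metric.isOpen_ball.mem_nhds (Metric.ball_subset_ball hR.le hz1)))
      rintro rfl
      exact hz2 (Metric.mem_closedBall_self hr0.le))
  simp only [sub_zero, smul_eq_mul] at hann
  rw [key R (hr0.trans_le hrR) hR, key r hr0 (hrR.trans_lt hR)] at hann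
  exact (mul_left_cancel₀ Complex.two_pi_I_ne_zero hann).symm

lemma real_mul_circle_mem_ball {r : ℝ} (hr0 : 0 ≤ r) (hr : r < 1) (ξ : Circle) :
    (r * ξ : ℂ) ∈ Metric.ball (0 : ℂ) 1 := by
  simpa [Circle.norm_coe, abs_of_nonneg hr0] using hr

lemma continuous_comp_real_mul_circle_of_differentiableOn {h : ℂ → ℂ}
    (hd : DifferentiableOn ℂ h (Metric.ball 0 1)) {r : ℝ} (hr0 : 0 ≤ r) (hr : r < 1) :
    Continuous fun ξ : Circle => h (r * ξ) :=
  hd.continuousOn.comp_continuous (continuous_const.mul continuous_circle_coe)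
    (real_mul_circle_mem_ball hr0 hr)

lemma continuous_circle_zpow (k : ℤ) : Continuous fun ξ : Circle => (ξ : ℂ) ^ k :=
  continuous_circle_coe.zpow₀ k fun ξ => Or.inl (Circle.coe_ne_zero ξ)

lemma norm_circle_zpow (ξ : Circle) (k : ℤ) : ‖(ξ : ℂ) ^ k‖ = 1 := by
  rw [norm_zpow, Circle.norm_coe, one_zpow]

/-- The moments of the boundary function of a bounded analytic function are the normalised
moments over interior circles. -/
lemma integral_zpow_mul_radialLimit {h : ℂ → ℂ} (hd : DifferentiableOn ℂ h (Metric.ball 0 1))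
    (hb : ∀ z ∈ Metric.ball (0 : ℂ) 1, ‖h z‖ ≤ 1) {l : Circle → ℂ}
    (hl : ∀ᵐ ξ : Circle ∂circleMeasure,
      Tendsto (fun r : ℝ => h (r * ξ)) (𝓝[<] (1 : ℝ)) (𝓝 (l ξ)))
    (k : ℤ) {R : ℝ} (hR0 : 0 < R) (hR : R < 1) :
    ∫ ξ : Circle, (ξ : ℂ) ^ k * l ξ ∂circleMeasure =
      (R : ℂ) ^ k * ∫ ξ : Circle, (ξ : ℂ) ^ k * h (R * ξ) ∂circleMeasure := by
  have hI : ∀ᶠ r : ℝ in 𝓝[<] (1 : ℝ), r ∈ Set.Ioo R 1 := Ioo_mem_nhdsLT hR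
  have h1 : Tendsto (fun r : ℝ => ∫ ξ : Circle, (ξ : ℂ) ^ k * h (r * ξ) ∂circleMeasure)
      (𝓝[<] (1 : ℝ)) (𝓝 (∫ ξ : Circle, (ξ : ℂ) ^ k * l ξ ∂circleMeasure)) := by
    refine tendsto_integral_filter_of_dominated_convergence (fun _ => (1 : ℝ)) ?_ ?_
      (integrable_const _) ?_
    · filter_upwards [hI] with r hr
      exact ((continuous_circle_zpow k).mul (continuous_comp_real_mul_circle_of_differentiableOn hd
        (hR0.trans hr.1).le hr.2)).aestronglyMeasurable
    · filter_upwards [hI] with r hr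
      refine ae_of_all _ fun ξ => ?_
      rw [norm_mul, norm_circle_zpow, one_mul]
      exact hb _ (real_mul_circle_mem_ball (hR0.trans hr.1).le hr.2 ξ)
    · filter_upwards [hl] with ξ hξ
      exact hξ.const_mul _
  have h2 : Tendsto (fun r : ℝ => (r : ℂ) ^ k) (𝓝[<] (1 : ℝ)) (𝓝 1) := by
    have : ContinuousAt (fun r : ℝ => (r : ℂ) ^ k) 1 :=
      Complex.continuous_ofReal.continuousAt.zpow₀ k (Or.inl (by simp))
    have := this.tendsto
    simp only [Complex.ofReal_one, one_zpow] at this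
    exact tendsto_nhdsWithin_of_tendsto_nhds this
  have h3 := h2.mul h1
  rw [one_mul] at h3
  refine tendsto_nhds_unique h3 (tendsto_const_nhds.congr' ?_)
  filter_upwards [hI] with r hr
  exact zpow_mul_integral_eq hd k hR0 hr.1.le hr.2

/-! ### The boundary map -/

lemma hasRadialLimit_boundaryMap {g : ℂ → ℂ} (hg : IsInner g) :
    ∀ᵐ ξ ∂circleMeasure, HasRadialLimit g ξ (boundaryMap g ξ) := by
  filter_upwards [hg.radialLimit] with ξ hξ
  rw [boundaryMap, dif_pos hξ]
  exact hξ.choose_spec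

lemma IsInner.norm_le_one {g : ℂ → ℂ} (hg : IsInner g) :
    ∀ z ∈ Metric.ball (0 : ℂ) 1, ‖g z‖ ≤ 1 := fun z hz => by
  simpa using (mem_ball_zero_iff.1 (hg.mapsTo hz)).le

lemma aemeasurable_radialLimit {h : ℂ → ℂ} (hd : DifferentiableOn ℂ h (Metric.ball 0 1))
    {l : Circle → ℂ} (hl : ∀ᵐ ξ : Circle ∂circleMeasure,
      Tendsto (fun r : ℝ => h (r * ξ)) (𝓝[<] (1 : ℝ)) (𝓝 (l ξ))) :
    AEMeasurable l circleMeasure := by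
  obtain ⟨u, -, hu, hlim⟩ := exists_seq_strictMono_tendsto' (show (0 : ℝ) < 1 by norm_num)
  refine aemeasurable_of_tendsto_metrizable_ae atTop
    (f := fun n (ξ : Circle) => h (u n * ξ)) (fun n => ?_) ?_
  · exact (continuous_comp_real_mul_circle_of_differentiableOn hd (hu n).1.le
      (hu n).2).measurable.aemeasurable
  · filter_upwards [hl] with ξ hξ
    exact hξ.comp (tendsto_nhdsWithin_iff.2 ⟨hlim, Eventually.of_forall fun n => (hu n).2⟩)

lemma aemeasurable_boundaryMap {g : ℂ → ℂ} (hg : IsInner g) :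
    AEMeasurable (boundaryMap g) circleMeasure := by
  have h1 : AEMeasurable (fun ξ => (boundaryMap g ξ : ℂ)) circleMeasure :=
    aemeasurable_radialLimit hg.differentiableOn (hasRadialLimit_boundaryMap hg)
  -- a measurable retraction of `ℂ` onto the circle
  have h2 : Measurable fun w : ℂ => Circle.exp (Complex.arg w) :=
    Circle.exp.continuous.measurable.comp Complex.measurable_arg
  have h3 := h2.comp_aemeasurable h1
  simpa only [Function.comp_def, Circle.exp_arg] using h3

/-! ### Trigonometric polynomials -/

/-- The monomial `ξ ^ k` as a continuous function on the circle. -/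
noncomputable def circleMonomial (k : ℤ) : C(Circle, ℂ) :=
  ⟨fun ξ => (ξ : ℂ) ^ k, continuous_circle_zpow k⟩

@[simp] lemma circleMonomial_apply (k : ℤ) (ξ : Circle) : circleMonomial k ξ = (ξ : ℂ) ^ k := rfl

lemma conj_circle_zpow (ξ : Circle) (k : ℤ) : conj ((ξ : ℂ) ^ k) = (ξ : ℂ) ^ (-k) := by
  rw [map_zpow₀, ← Circle.coe_inv_eq_conj, Circle.coe_inv, inv_zpow, zpow_neg]

/-- By the Stone–Weierstrass theorem, trigonometric polynomials are dense in `C(∂𝔻)`. -/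
lemma span_circleMonomial_closure_eq_top :
    (Submodule.span ℂ (Set.range circleMonomial)).topologicalClosure = ⊤ := by
  let A : StarSubalgebra ℂ C(Circle, ℂ) :=
    { toSubalgebra := Algebra.adjoin ℂ (Set.range circleMonomial)
      star_mem' := by
        change Algebra.adjoin ℂ (Set.range circleMonomial) ≤
          star (Algebra.adjoin ℂ (Set.range circleMonomial))
        refine Algebra.adjoin_le ?_
        rintro - ⟨k, rfl⟩
        exact Algebra.subset_adjoin ⟨-k, ContinuousMap.ext fun ξ => (conj_circle_zpow ξ k).symm⟩ }
  have hA : Subalgebra.toSubmodule A.toSubalgebra =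
      Submodule.span ℂ (Set.range circleMonomial) := by
    apply Algebra.adjoin_eq_span_of_subset
    refine Set.Subset.trans ?_ Submodule.subset_span
    intro x hx
    refine Submonoid.closure_induction (fun _ => id) ⟨0, ?_⟩ ?_ hx
    · ext ξ
      simp
    · rintro - - - - ⟨m, rfl⟩ ⟨n, rfl⟩
      refine ⟨m + n, ?_⟩
      ext ξ
      simp [zpow_add₀ (Circle.coe_ne_zero ξ)]
  have hsep : A.SeparatesPoints := by
    intro x y hxy
    refine ⟨_, ⟨circleMonomial 1, Algebra.subset_adjoin ⟨1, rfl⟩, rfl⟩, ?_⟩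
    simpa [Circle.coe_inj] using hxy
  rw [← hA]
  exact congr_arg (Subalgebra.toSubmodule <| StarSubalgebra.toSubalgebra ·)
    (ContinuousMap.starSubalgebra_topologicalClosure_eq_top_of_separatesPoints A hsep)

lemma memLp_circleMonomial (k : ℤ) : MemLp (circleMonomial k) 2 circleMeasure :=
  MemLp.of_bound (circleMonomial k).continuous.aestronglyMeasurable 1
    (ae_of_all _ fun ξ => (norm_circle_zpow ξ k).le)

lemma span_toLp_circleMonomial_closure_eq_top :
    (Submodule.span ℂ (Set.range fun k => (memLp_circleMonomial k).toLp)).topologicalClosure =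
      ⊤ := by
  have h := (ContinuousMap.toLp_denseRange ℂ circleMeasure ℂ
    (p := 2) (by norm_num)).topologicalClosure_map_submodule span_circleMonomial_closure_eq_top
  rw [Submodule.map_span, ← Set.range_comp] at h
  exact h

lemma integral_circle_zpow {k : ℤ} (hk : k ≠ 0) :
    ∫ ξ : Circle, (ξ : ℂ) ^ k ∂circleMeasure = 0 := by
  have hpos : ∀ n : ℕ, n ≠ 0 → ∫ ξ : Circle, (ξ : ℂ) ^ n ∂circleMeasure = 0 := by
    intro n hn
    have h := integral_real_mul_eq (h := fun z => z ^ n) (by fun_prop)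
      (show (0 : ℝ) < 1 / 2 by norm_num) (by norm_num)
    simp only [mul_pow, zero_pow hn, integral_const_mul] at h
    exact (mul_eq_zero.1 h).resolve_left (by simp)
  obtain ⟨n, rfl | rfl⟩ := k.eq_nat_or_neg
  · simpa using hpos n (by simpa using hk)
  · have := congrArg conj (hpos n (by simpa using hk))
    rw [← integral_conj, map_zero] at this
    rw [← this]
    congr 1 with ξ
    rw [← zpow_natCast, conj_circle_zpow]

/-- Normalised Lebesgue measure is determined by its moments; those of negative order are the
complex conjugates of those of positive order. -/
lemma eq_circleMeasure_of_integral_pow {ν : Measure Circle} [IsProbabilityMeasure ν]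
    (h : ∀ n : ℕ, n ≠ 0 → ∫ ξ : Circle, (ξ : ℂ) ^ n ∂ν = 0) : ν = circleMeasure := by
  have hint : ∀ (μ : Measure Circle) [IsProbabilityMeasure μ] (f : C(Circle, ℂ)),
      Integrable f μ := fun μ _ f =>
    f.continuous.integrable_of_hasCompactSupport (HasCompactSupport.of_compactSpace _)
  let I (μ : Measure Circle) [IsProbabilityMeasure μ] : C(Circle, ℂ) →L[ℂ] ℂ :=
    LinearMap.mkContinuous
      { toFun := fun f => ∫ ξ, f ξ ∂μ
        map_add' := fun f g => integral_add (hint μ f) (hint μ g)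
        map_smul' := fun c f => integral_const_mul c f } 1 fun f => by
      rw [one_mul]
      refine (norm_integral_le_of_norm_le_const (ae_of_all _ f.norm_coe_le_norm)).trans ?_
      simp
  have hI : I ν = I circleMeasure := by
    refine ContinuousLinearMap.ext_on
      (Submodule.dense_iff_topologicalClosure_eq_top.2 span_circleMonomial_closure_eq_top) ?_
    rintro - ⟨k, rfl⟩
    change ∫ ξ : Circle, (ξ : ℂ) ^ k ∂ν = ∫ ξ : Circle, (ξ : ℂ) ^ k ∂circleMeasure
    rcases eq_or_ne k 0 with rfl | hk
    · simp
    rw [integral_circle_zpow hk]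
    obtain ⟨n, rfl | rfl⟩ := k.eq_nat_or_neg
    · simpa using h n (by simpa using hk)
    · have := congrArg conj (h n (by simpa using hk))
      rw [← integral_conj, map_zero] at this
      rw [← this]
      congr 1 with ξ
      rw [← zpow_natCast, conj_circle_zpow]
  refine ext_of_forall_integral_eq_of_IsFiniteMeasure fun f => ?_
  have := DFunLike.congr_fun hI ⟨fun ξ => (f ξ : ℂ), Complex.continuous_ofReal.comp f.continuous⟩
  change ∫ ξ, (f ξ : ℂ) ∂ν = ∫ ξ, (f ξ : ℂ) ∂circleMeasure at this
  rw [integral_complex_ofReal, integral_complex_ofReal] at this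
  exact_mod_cast this

/-- Square-integrable functions on the circle are determined by their Fourier coefficients. -/
lemma ae_eq_of_integral_zpow_mul_eq {u v : Circle → ℂ} (hu : MemLp u 2 circleMeasure)
    (hv : MemLp v 2 circleMeasure)
    (h : ∀ k : ℤ, ∫ ξ : Circle, (ξ : ℂ) ^ k * u ξ ∂circleMeasure =
      ∫ ξ : Circle, (ξ : ℂ) ^ k * v ξ ∂circleMeasure) : u =ᵐ[circleMeasure] v := by
  have inner_eq : ∀ (k : ℤ) (w : Circle → ℂ) (hw : MemLp w 2 circleMeasure),
      inner ℂ ((memLp_circleMonomial k).toLp) (hw.toLp) =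
        ∫ ξ : Circle, (ξ : ℂ) ^ (-k) * w ξ ∂circleMeasure := by
    intro k w hw
    rw [L2.inner_def]
    refine integral_congr_ae ?_
    filter_upwards [(memLp_circleMonomial k).coeFn_toLp, hw.coeFn_toLp] with ξ h1 h2
    rw [h1, h2, circleMonomial_apply, RCLike.inner_apply', conj_circle_zpow]
  have horth : hu.toLp - hv.toLp ∈
      (Submodule.span ℂ (Set.range fun k => (memLp_circleMonomial k).toLp))ᗮ := by
    rw [Submodule.mem_orthogonal]
    intro x hx
    induction hx using Submodule.span_induction with
    | mem x hx =>
      obtain ⟨k, rfl⟩ := hx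
      rw [inner_sub_right, inner_eq, inner_eq, h, sub_self]
    | zero => simp
    | add x y _ _ hx hy => rw [inner_add_left, hx, hy, add_zero]
    | smul c x _ hx => rw [inner_smul_left, hx, mul_zero]
  rw [(Submodule.topologicalClosure_eq_top_iff).1 span_toLp_circleMonomial_closure_eq_top,
    Submodule.mem_bot, sub_eq_zero] at horth
  exact (MemLp.toLp_eq_toLp_iff hu hv).1 horth

/-! ### Invariance of Lebesgue measure -/

/-- The boundary map of an inner function fixing the origin preserves Lebesgue measure. -/
lemma map_boundaryMap {g : ℂ → ℂ} (hg : IsInner g) (hg0 : g 0 = 0) :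
    circleMeasure.map (boundaryMap g) = circleMeasure := by
  have hm := aemeasurable_boundaryMap hg
  have := Measure.isProbabilityMeasure_map hm
  refine eq_circleMeasure_of_integral_pow fun n hn => ?_
  rw [integral_map hm (by fun_prop)]
  have hd : DifferentiableOn ℂ (fun z => g z ^ n) (Metric.ball 0 1) := hg.differentiableOn.pow n
  have h := integral_zpow_mul_radialLimit hd
    (fun z hz => by
      rw [norm_pow]
      exact pow_le_one₀ (norm_nonneg _) (hg.norm_le_one z hz))
    (l := fun ξ => (boundaryMap g ξ : ℂ) ^ n)
    ((hasRadialLimit_boundaryMap hg).mono fun ξ hξ => hξ.pow n) 0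
    (show (0 : ℝ) < 1 / 2 by norm_num) (by norm_num)
  simp only [zpow_zero, one_mul] at h
  rw [h, integral_real_mul_eq hd (by norm_num) (by norm_num), hg0, zero_pow hn]

/-! ### Composition of inner functions -/

lemma isInner_id : IsInner id where
  differentiableOn := differentiableOn_id
  mapsTo := Set.mapsTo_id _
  radialLimit := ae_of_all _ fun ξ => ⟨ξ, tendsto_nhdsWithin_of_tendsto_nhds (by
    have : Continuous fun r : ℝ => (r : ℂ) * (ξ : ℂ) := by fun_prop
    simpa using this.tendsto 1)⟩

/-- The composition of inner functions is inner when the first one applied fixes the origin.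
Radial limits of `f ∘ g` exist by Fatou's theorem. They are identified with `f̂ ∘ ĝ` by comparing
moments: this is immediate for the dilations `z ↦ f (s z)`, which are continuous up to the
boundary, and passes to the limit `s → 1` because `ĝ` preserves null sets. -/
theorem IsInner.comp {f g : ℂ → ℂ} (hf : IsInner f) (hg : IsInner g) (hg0 : g 0 = 0) :
    IsInner (f ∘ g) := by
  have hd : DifferentiableOn ℂ (f ∘ g) (Metric.ball 0 1) :=
    hf.differentiableOn.comp hg.differentiableOn hg.mapsTo
  have hmaps : Set.MapsTo (f ∘ g) (Metric.ball 0 1) (Metric.ball 0 1) := hf.mapsTo.comp hg.mapsTo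
  have hb : ∀ z ∈ Metric.ball (0 : ℂ) 1, ‖(f ∘ g) z‖ ≤ 1 := fun z hz =>
    hf.norm_le_one _ (hg.mapsTo hz)
  refine ⟨hd, hmaps, ?_⟩
  obtain ⟨l, hl⟩ := (ae_exists_radialLimit hd hb).choice
  have hI : ∀ᶠ r : ℝ in 𝓝[<] (1 : ℝ), r ∈ Set.Ioo 0 1 := Ioo_mem_nhdsLT one_pos
  have hgm := aemeasurable_boundaryMap hg
  have hmap := map_boundaryMap hg hg0
  have hfg : AEMeasurable (fun ξ => boundaryMap f (boundaryMap g ξ)) circleMeasure := by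
    have := aemeasurable_boundaryMap hf
    rw [← hmap] at this
    exact this.comp_aemeasurable hgm
  have hflim : ∀ᵐ ξ ∂circleMeasure,
      HasRadialLimit f (boundaryMap g ξ) (boundaryMap f (boundaryMap g ξ)) := by
    have := hasRadialLimit_boundaryMap hf
    rw [← hmap] at this
    exact ae_of_ae_map hgm this
  have hfc : ∀ z ∈ Metric.ball (0 : ℂ) 1, ContinuousAt f z := fun z hz =>
    (hf.differentiableOn.differentiableAt (Metric.isOpen_ball.mem_nhds hz)).continuousAt
  have hsmall : ∀ s : ℝ, s ∈ Set.Ioo (0 : ℝ) 1 → ∀ z ∈ Metric.closedBall (0 : ℂ) 1,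
      (s : ℂ) * z ∈ Metric.ball (0 : ℂ) 1 := by
    intro s hs z hz
    rw [mem_ball_zero_iff, norm_mul, Complex.norm_real, Real.norm_of_nonneg hs.1.le]
    have := mem_closedBall_zero_iff.1 hz
    nlinarith [hs.1, hs.2]
  have hcirc : ∀ ξ : Circle, (ξ : ℂ) ∈ Metric.closedBall (0 : ℂ) 1 := fun ξ =>
    mem_closedBall_zero_iff.2 (Circle.norm_coe ξ).le
  have hR : ∀ ξ : Circle, ((1 / 2 : ℝ) * ξ : ℂ) ∈ Metric.ball (0 : ℂ) 1 :=
    real_mul_circle_mem_ball (by norm_num) (by norm_num)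
  have hcoef : ∀ k : ℤ, ∫ ξ : Circle, (ξ : ℂ) ^ k * l ξ ∂circleMeasure =
      ∫ ξ : Circle, (ξ : ℂ) ^ k * boundaryMap f (boundaryMap g ξ) ∂circleMeasure := by
    intro k
    have hdil : ∀ s : ℝ, s ∈ Set.Ioo (0 : ℝ) 1 →
        ∫ ξ : Circle, (ξ : ℂ) ^ k * f (s * boundaryMap g ξ) ∂circleMeasure =
        ((1 / 2 : ℝ) : ℂ) ^ k *
          ∫ ξ : Circle, (ξ : ℂ) ^ k * f (s * g ((1 / 2 : ℝ) * ξ)) ∂circleMeasure := by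
      intro s hs
      have hms : Set.MapsTo (fun z => (s : ℂ) * g z) (Metric.ball 0 1) (Metric.ball 0 1) :=
        fun z hz => hsmall s hs _ (Metric.ball_subset_closedBall (hg.mapsTo hz))
      refine integral_zpow_mul_radialLimit (h := fun z => f (s * g z))
        (hf.differentiableOn.comp (hg.differentiableOn.const_mul _) hms)
        (fun z hz => hf.norm_le_one _ (hms hz)) ?_ k (by norm_num) (by norm_num)
      filter_upwards [hasRadialLimit_boundaryMap hg] with ξ hξ
      exact (hfc _ (hsmall s hs _ (hcirc _))).tendsto.comp (hξ.const_mul (s : ℂ))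
    have hlim1 : Tendsto
        (fun s : ℝ => ∫ ξ : Circle, (ξ : ℂ) ^ k * f (s * boundaryMap g ξ) ∂circleMeasure)
        (𝓝[<] 1)
        (𝓝 (∫ ξ : Circle, (ξ : ℂ) ^ k * boundaryMap f (boundaryMap g ξ) ∂circleMeasure)) := by
      refine tendsto_integral_filter_of_dominated_convergence (fun _ => (1 : ℝ)) ?_ ?_
        (integrable_const _) ?_
      · filter_upwards [hI] with s hs
        have : Continuous fun ξ : Circle => f (s * ξ) :=
          continuous_comp_real_mul_circle_of_differentiableOn hf.differentiableOn hs.1.le hs.2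
        exact ((continuous_circle_zpow k).measurable.aemeasurable.mul
          (this.measurable.comp_aemeasurable hgm)).aestronglyMeasurable
      · filter_upwards [hI] with s hs
        refine ae_of_all _ fun ξ => ?_
        rw [norm_mul, norm_circle_zpow, one_mul]
        exact hf.norm_le_one _ (hsmall s hs _ (hcirc _))
      · filter_upwards [hflim] with ξ hξ
        exact hξ.const_mul _
    have hlim2 : Tendsto
        (fun s : ℝ => ((1 / 2 : ℝ) : ℂ) ^ k *
          ∫ ξ : Circle, (ξ : ℂ) ^ k * f (s * g ((1 / 2 : ℝ) * ξ)) ∂circleMeasure)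
        (𝓝[<] 1)
        (𝓝 (((1 / 2 : ℝ) : ℂ) ^ k *
          ∫ ξ : Circle, (ξ : ℂ) ^ k * (f ∘ g) ((1 / 2 : ℝ) * ξ) ∂circleMeasure)) := by
      refine Tendsto.const_mul _ (tendsto_integral_filter_of_dominated_convergence
        (fun _ => (1 : ℝ)) ?_ ?_ (integrable_const _) (ae_of_all _ fun ξ => ?_))
      · filter_upwards [hI] with s hs
        have hgc := continuous_comp_real_mul_circle_of_differentiableOn hg.differentiableOn
          (show (0 : ℝ) ≤ 1 / 2 by norm_num) (by norm_num)
        have : Continuous fun ξ : Circle => f (s * g ((1 / 2 : ℝ) * ξ)) :=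
          hf.differentiableOn.continuousOn.comp_continuous (continuous_const.mul hgc) fun ξ =>
            hsmall s hs _ (Metric.ball_subset_closedBall (hg.mapsTo (hR ξ)))
        exact ((continuous_circle_zpow k).mul this).aestronglyMeasurable
      · filter_upwards [hI] with s hs
        refine ae_of_all _ fun ξ => ?_
        rw [norm_mul, norm_circle_zpow, one_mul]
        exact hf.norm_le_one _
          (hsmall s hs _ (Metric.ball_subset_closedBall (hg.mapsTo (hR ξ))))
      · have h1 : Tendsto (fun s : ℝ => (s : ℂ) * g ((1 / 2 : ℝ) * ξ)) (𝓝[<] 1)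
            (𝓝 (g ((1 / 2 : ℝ) * ξ))) := by
          have : Continuous fun s : ℝ => (s : ℂ) * g ((1 / 2 : ℝ) * ξ) := by fun_prop
          have := this.tendsto 1
          rw [Complex.ofReal_one, one_mul] at this
          exact tendsto_nhdsWithin_of_tendsto_nhds this
        exact ((hfc _ (hg.mapsTo (hR ξ))).tendsto.comp h1).const_mul _
    rw [integral_zpow_mul_radialLimit hd hb hl k (show (0 : ℝ) < 1 / 2 by norm_num) (by norm_num)]
    refine tendsto_nhds_unique hlim2 (hlim1.congr' ?_)
    filter_upwards [hI] with s hs using hdil s hs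
  have hlb : ∀ᵐ ξ ∂circleMeasure, ‖l ξ‖ ≤ 1 := by
    filter_upwards [hl] with ξ hξ
    refine le_of_tendsto hξ.norm ?_
    filter_upwards [hI] with r hr
    exact hb _ (real_mul_circle_mem_ball hr.1.le hr.2 ξ)
  have heq := ae_eq_of_integral_zpow_mul_eq
    (MemLp.of_bound (aemeasurable_radialLimit hd hl).aestronglyMeasurable 1 hlb)
    (MemLp.of_bound (continuous_circle_coe.measurable.comp_aemeasurable hfg).aestronglyMeasurable 1
      (ae_of_all _ fun ξ => (Circle.norm_coe _).le)) hcoef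
  filter_upwards [hl, heq] with ξ h1 h2
  rw [h2] at h1
  exact ⟨_, h1⟩

lemma composition_zero_eq {g : ℕ → ℂ → ℂ} (hg0 : ∀ n : ℕ, 1 ≤ n → g n 0 = 0) (n : ℕ) :
    composition g n 0 = 0 := by
  induction n with
  | zero => rfl
  | succ n ih =>
    change g (n + 1) (composition g n 0) = 0
    rw [ih, hg0 _ (by omega)]

lemma isInner_composition {g : ℕ → ℂ → ℂ} (hg : ∀ n : ℕ, 1 ≤ n → IsInner (g n))
    (hg0 : ∀ n : ℕ, 1 ≤ n → g n 0 = 0) (n : ℕ) : IsInner (composition g n) := by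
  induction n with
  | zero => exact isInner_id
  | succ n ih => exact (hg _ (by omega)).comp ih (composition_zero_eq hg0 n)

/-! ### Decay of correlations -/

section Correlations

/-- Weak convergence to zero of a bounded sequence can be tested on a set with dense span. -/
lemma tendsto_inner_zero_of_dense {H : Type*} [NormedAddCommGroup H] [InnerProductSpace ℂ H]
    {S : Set H} (hS : (Submodule.span ℂ S).topologicalClosure = ⊤) {x : ℕ → H} {C : ℝ}
    (hx : ∀ n, ‖x n‖ ≤ C) (h : ∀ f ∈ S, Tendsto (fun n => inner ℂ f (x n)) atTop (𝓝 0)) (f : H) :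
    Tendsto (fun n => inner ℂ f (x n)) atTop (𝓝 0) := by
  have hspan : ∀ f ∈ Submodule.span ℂ S, Tendsto (fun n => inner ℂ f (x n)) atTop (𝓝 0) := by
    intro f hf
    induction hf using Submodule.span_induction with
    | mem f hf => exact h f hf
    | zero => simp
    | add f g _ _ hf hg => simpa [inner_add_left] using hf.add hg
    | smul c f _ hf => simpa [inner_smul_left] using hf.mul_const (conj c)
  have hC : 0 ≤ C := (norm_nonneg _).trans (hx 0)
  refine Metric.tendsto_atTop.2 fun ε hε => ?_
  have hf : f ∈ closure (Submodule.span ℂ S : Set H) := by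
    have : f ∈ (Submodule.span ℂ S).topologicalClosure := by rw [hS]; trivial
    exact this
  obtain ⟨f', hf', hdist⟩ := Metric.mem_closure_iff.1 hf (ε / (2 * (C + 1))) (by positivity)
  obtain ⟨N, hN⟩ := Metric.tendsto_atTop.1 (hspan f' hf') (ε / 2) (by positivity)
  refine ⟨N, fun n hn => ?_⟩
  have h1 := hN n hn
  rw [dist_zero_right] at h1 ⊢
  rw [dist_eq_norm] at hdist
  have h2 : ‖inner ℂ (f - f') (x n)‖ ≤ ε / 2 := by
    refine (norm_inner_le_norm _ _).trans ?_
    calc ‖f - f'‖ * ‖x n‖ ≤ ε / (2 * (C + 1)) * (C + 1) := by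
          gcongr
          linarith [hx n]
      _ = ε / 2 := by field_simp
  have h3 : inner ℂ f (x n) = inner ℂ (f - f') (x n) + inner ℂ f' (x n) := by
    rw [inner_sub_left, sub_add_cancel]
  rw [h3]
  linarith [norm_add_le (inner ℂ (f - f') (x n)) (inner ℂ f' (x n))]

/-- Weak operator convergence to zero of a bounded sequence of operators can be tested on a set
with dense span, in both variables: the second one is reduced to the first by adjoints. -/
lemma tendsto_inner_apply_zero_of_dense {H : Type*} [NormedAddCommGroup H]
    [InnerProductSpace ℂ H] [CompleteSpace H] {S : Set H}
    (hS : (Submodule.span ℂ S).topologicalClosure = ⊤) {V : ℕ → H →L[ℂ] H} {C : ℝ}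
    (hV : ∀ n, ‖V n‖ ≤ C)
    (h : ∀ f ∈ S, ∀ g ∈ S, Tendsto (fun n => inner ℂ f (V n g)) atTop (𝓝 0)) (f g : H) :
    Tendsto (fun n => inner ℂ f (V n g)) atTop (𝓝 0) := by
  have h1 : ∀ f : H, ∀ g ∈ S, Tendsto (fun n => inner ℂ f (V n g)) atTop (𝓝 0) := fun f g hg =>
    tendsto_inner_zero_of_dense hS (x := fun n => V n g) (C := C * ‖g‖)
      (fun n => (V n).le_of_opNorm_le (hV n) g) (fun f hf => h f hf g hg) f
  have h2 := tendsto_inner_zero_of_dense hS (x := fun n => ContinuousLinearMap.adjoint (V n) f)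
    (C := C * ‖f‖)
    (fun n => (ContinuousLinearMap.adjoint (V n)).le_of_opNorm_le
      (by rw [LinearIsometryEquiv.norm_map]; exact hV n) f)
    (fun g hg => by
      have := (Complex.continuous_conj.tendsto 0).comp (h1 f g hg)
      rw [map_zero] at this
      refine this.congr fun n => ?_
      rw [ContinuousLinearMap.adjoint_inner_right, Function.comp_apply, inner_conj_symm]) g
  have := (Complex.continuous_conj.tendsto 0).comp h2
  rw [map_zero] at this
  refine this.congr fun n => ?_
  rw [Function.comp_apply, inner_conj_symm, ContinuousLinearMap.adjoint_inner_left]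

variable {X : Type*} [MeasurableSpace X] {μ : Measure X}

lemma inner_toLp_toLp {u v : X → ℂ} (hu : MemLp u 2 μ) (hv : MemLp v 2 μ) :
    inner ℂ hu.toLp hv.toLp = ∫ x, conj (u x) * v x ∂μ := by
  rw [L2.inner_def]
  refine integral_congr_ae ?_
  filter_upwards [hu.coeFn_toLp, hv.coeFn_toLp] with x h1 h2
  rw [h1, h2, RCLike.inner_apply']

/-- Decay of correlations for a sequence of measure-preserving maps propagates from a family with
dense linear span in `L²` to all of `L²`. -/
theorem tendsto_correlation_of_dense [IsProbabilityMeasure μ] {T : ℕ → X → X}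
    (hT : ∀ n, AEMeasurable (T n) μ) (hTμ : ∀ n, μ.map (T n) = μ) {ι : Type*} {φ : ι → X → ℂ}
    (hφ : ∀ i, MemLp (φ i) 2 μ)
    (hdense : (Submodule.span ℂ (Set.range fun i => (hφ i).toLp)).topologicalClosure = ⊤)
    (h : ∀ i j, Tendsto (fun n => ∫ x, conj (φ i x) * φ j (T n x) ∂μ) atTop
      (𝓝 ((∫ x, conj (φ i x) ∂μ) * ∫ x, φ j x ∂μ)))
    {u v : X → ℂ} (hu : MemLp u 2 μ) (hv : MemLp v 2 μ) :
    Tendsto (fun n => ∫ x, conj (u x) * v (T n x) ∂μ) atTop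
      (𝓝 ((∫ x, conj (u x) ∂μ) * ∫ x, v x ∂μ)) := by
  have hmp : ∀ n, MeasurePreserving ((hT n).mk (T n)) μ μ := fun n =>
    ⟨(hT n).measurable_mk, by rw [← Measure.map_congr (hT n).ae_eq_mk, hTμ n]⟩
  have h1 : MemLp (fun _ : X => (1 : ℂ)) 2 μ := memLp_const 1
  -- the Koopman operator of `T n` minus the projection onto the constants
  let U (n : ℕ) : Lp ℂ 2 μ →L[ℂ] Lp ℂ 2 μ :=
    (Lp.compMeasurePreservingₗᵢ ℂ _ (hmp n)).toContinuousLinearMap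
  let P : Lp ℂ 2 μ →L[ℂ] Lp ℂ 2 μ := (innerSL ℂ h1.toLp).smulRight h1.toLp
  have hV : ∀ n, ‖U n - P‖ ≤ 1 + ‖P‖ := fun n =>
    (norm_sub_le _ _).trans (add_le_add_left (LinearIsometry.norm_toContinuousLinearMap_le _) _)
  have hUP : ∀ {u v : X → ℂ} (hu : MemLp u 2 μ) (hv : MemLp v 2 μ) (n : ℕ),
      inner ℂ hu.toLp ((U n - P) hv.toLp) =
        (∫ x, conj (u x) * v (T n x) ∂μ) - (∫ x, conj (u x) ∂μ) * ∫ x, v x ∂μ := by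
    intro u v hu hv n
    have e1 : U n hv.toLp = (hv.comp_measurePreserving (hmp n)).toLp :=
      Lp.toLp_compMeasurePreserving hv (hmp n)
    have e2 : P hv.toLp = inner ℂ h1.toLp hv.toLp • h1.toLp := rfl
    rw [_root_.sub_apply, inner_sub_right, e1, e2, inner_smul_right, inner_toLp_toLp,
      inner_toLp_toLp, inner_toLp_toLp]
    simp only [map_one, one_mul, mul_one]
    rw [mul_comm (∫ x, v x ∂μ)]
    congr 1
    refine integral_congr_ae ?_
    filter_upwards [(hT n).ae_eq_mk] with x hx
    rw [Function.comp_apply, hx]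
  have hlim := tendsto_inner_apply_zero_of_dense hdense hV (by
    rintro - ⟨i, rfl⟩ - ⟨j, rfl⟩
    simp only [hUP]
    exact tendsto_sub_nhds_zero_iff.2 (h i j)) hu.toLp hv.toLp
  simp only [hUP] at hlim
  exact tendsto_sub_nhds_zero_iff.1 hlim

lemma memLp_indicator_one [IsProbabilityMeasure μ] {A : Set X} (hA : MeasurableSet A) :
    MemLp (A.indicator fun _ => (1 : ℂ)) 2 μ := (memLp_const 1).indicator hA

lemma span_toLp_indicator_closure_eq_top [IsProbabilityMeasure μ] :
    (Submodule.span ℂ (Set.range fun A : {A : Set X // MeasurableSet A} =>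
      (memLp_indicator_one (μ := μ) A.2).toLp)).topologicalClosure = ⊤ := by
  rw [eq_top_iff]
  intro f _
  set K := (Submodule.span ℂ (Set.range fun A : {A : Set X // MeasurableSet A} =>
      (memLp_indicator_one (μ := μ) A.2).toLp)).topologicalClosure with hK
  refine Lp.induction (p := 2) (by norm_num) (motive := fun f => f ∈ K) ?_ ?_ ?_ f
  · intro c s hs hμs
    have h1 : (memLp_indicator_one (μ := μ) hs).toLp ∈ K :=
      Submodule.le_topologicalClosure _ (Submodule.subset_span ⟨⟨s, hs⟩, rfl⟩)
    convert K.smul_mem c h1 using 1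
    rw [Lp.simpleFunc.coe_indicatorConst, ← MemLp.toLp_const_smul]
    refine (MemLp.toLp_eq_toLp_iff _ _).2 (ae_of_all _ fun x => ?_)
    by_cases hx : x ∈ s <;> simp [hx]
  · intro f g hf hg _ hf' hg'
    exact K.add_mem hf' hg'
  · exact Submodule.isClosed_topologicalClosure _

lemma integral_conj_indicator_mul_indicator {T : X → X} (hT : AEMeasurable T μ) {A B : Set X}
    (hA : MeasurableSet A) (hB : MeasurableSet B) :
    ∫ x, conj (A.indicator (fun _ => (1 : ℂ)) x) * B.indicator (fun _ => (1 : ℂ)) (T x) ∂μ =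
      (μ (A ∩ T ⁻¹' B)).toReal := by
  have : ∀ x, conj (A.indicator (fun _ => (1 : ℂ)) x) * B.indicator (fun _ => (1 : ℂ)) (T x) =
      (A ∩ T ⁻¹' B).indicator (fun _ => (1 : ℂ)) x := by
    intro x
    by_cases h1 : x ∈ A <;> by_cases h2 : T x ∈ B <;> simp [h1, h2]
  simp_rw [this]
  rw [integral_indicator₀ (hA.nullMeasurableSet.inter (hT.nullMeasurableSet_preimage hB))]
  simp [Measure.real]

lemma integral_conj_indicator {A : Set X} (hA : MeasurableSet A) :
    ∫ x, conj (A.indicator (fun _ => (1 : ℂ)) x) ∂μ = (μ A).toReal := by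
  rw [integral_conj, integral_indicator hA]
  simp [Measure.real]

/-- Mixing is decay of correlations for indicator functions. -/
lemma isMixingUsual_iff [IsProbabilityMeasure μ] {T : ℕ → X → X}
    (hT : ∀ n, AEMeasurable (T n) μ) :
    IsMixingUsual μ T ↔ ∀ A B : {A : Set X // MeasurableSet A},
      Tendsto (fun n => ∫ x, conj (A.1.indicator (fun _ => (1 : ℂ)) x) *
          B.1.indicator (fun _ => (1 : ℂ)) (T n x) ∂μ) atTop
        (𝓝 ((∫ x, conj (A.1.indicator (fun _ => (1 : ℂ)) x) ∂μ) *
          ∫ x, B.1.indicator (fun _ => (1 : ℂ)) x ∂μ)) := by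
  have key : ∀ A B : Set X, MeasurableSet A → MeasurableSet B →
      (Tendsto (fun n => μ (A ∩ T n ⁻¹' B)) atTop (𝓝 (μ A * μ B)) ↔
      Tendsto (fun n => ∫ x, conj (A.indicator (fun _ => (1 : ℂ)) x) *
          B.indicator (fun _ => (1 : ℂ)) (T n x) ∂μ) atTop
        (𝓝 ((∫ x, conj (A.indicator (fun _ => (1 : ℂ)) x) ∂μ) *
          ∫ x, B.indicator (fun _ => (1 : ℂ)) x ∂μ))) := by
    intro A B hA hB
    have e : ∫ x, B.indicator (fun _ => (1 : ℂ)) x ∂μ = (μ B).toReal := by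
      rw [integral_indicator hB]
      simp [Measure.real]
    simp_rw [integral_conj_indicator_mul_indicator (hT _) hA hB]
    rw [integral_conj_indicator hA, e, ← Complex.ofReal_mul, ← ENNReal.toReal_mul,
      ← ENNReal.tendsto_toReal_iff (fun n => measure_ne_top _ _)
        (ENNReal.mul_ne_top (measure_ne_top _ _) (measure_ne_top _ _))]
    exact tendsto_ofReal_iff.symm
  exact ⟨fun h A B => (key A B A.2 B.2).1 (h A B A.2 B.2),
    fun h A B hA hB => (key A B hA hB).2 (h ⟨A, hA⟩ ⟨B, hB⟩)⟩

end Correlations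

/-! ### Mixing and Taylor coefficients -/

/-- Mixing of measure-preserving self-maps of the circle can be tested on monomials, and by complex
conjugation on those with positive second exponent. -/
theorem isMixingUsual_circle_iff {T : ℕ → Circle → Circle}
    (hT : ∀ n, AEMeasurable (T n) circleMeasure)
    (hTm : ∀ n, circleMeasure.map (T n) = circleMeasure) :
    IsMixingUsual circleMeasure T ↔ ∀ (k : ℤ) (j : ℕ), j ≠ 0 →
      Tendsto (fun n => ∫ ξ : Circle, (ξ : ℂ) ^ k * (T n ξ : ℂ) ^ j ∂circleMeasure)
        atTop (𝓝 0) := by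
  rw [isMixingUsual_iff hT]
  constructor
  · intro h k j hj
    have h1 := tendsto_correlation_of_dense hT hTm _ span_toLp_indicator_closure_eq_top h
      (memLp_circleMonomial (-k)) (memLp_circleMonomial j)
    have hj' : (j : ℤ) ≠ 0 := by exact_mod_cast hj
    simp only [circleMonomial_apply, conj_circle_zpow, neg_neg] at h1
    rw [integral_circle_zpow hj', mul_zero] at h1
    simpa only [zpow_natCast] using h1
  · intro h A B
    refine tendsto_correlation_of_dense hT hTm memLp_circleMonomial
      span_toLp_circleMonomial_closure_eq_top (fun i j => ?_) (memLp_indicator_one A.2)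
      (memLp_indicator_one B.2)
    simp only [circleMonomial_apply]
    obtain ⟨j, rfl | rfl⟩ := j.eq_nat_or_neg
    · rcases eq_or_ne j 0 with rfl | hj
      · simp
      have hj' : (j : ℤ) ≠ 0 := by exact_mod_cast hj
      rw [integral_circle_zpow hj', mul_zero]
      simpa only [conj_circle_zpow, zpow_natCast] using h (-i) j hj
    · rcases eq_or_ne j 0 with rfl | hj
      · simp
      have hj' : -(j : ℤ) ≠ 0 := by simpa using hj
      rw [integral_circle_zpow hj', mul_zero]
      have := (Complex.continuous_conj.tendsto 0).comp (h i j hj)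
      rw [map_zero] at this
      refine this.congr fun n => ?_
      rw [Function.comp_apply, ← integral_conj]
      congr 1 with ξ
      rw [map_mul, ← zpow_natCast, conj_circle_zpow (T n ξ)]

/-- The Taylor expansion of a bounded analytic function in terms of its boundary function. -/
lemma hasSum_moment_mul_pow {h : ℂ → ℂ} (hd : DifferentiableOn ℂ h (Metric.ball 0 1))
    (hb : ∀ z ∈ Metric.ball (0 : ℂ) 1, ‖h z‖ ≤ 1) {l : Circle → ℂ}
    (hl : ∀ᵐ ξ : Circle ∂circleMeasure,
      Tendsto (fun r : ℝ => h (r * ξ)) (𝓝[<] (1 : ℝ)) (𝓝 (l ξ)))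
    {z : ℂ} (hz : ‖z‖ < 1) :
    HasSum (fun n : ℕ => (∫ ξ : Circle, (ξ : ℂ) ^ (-n : ℤ) * l ξ ∂circleMeasure) * z ^ n)
      (h z) := by
  obtain ⟨R, hzR, hR⟩ := exists_between hz
  have hR0 : 0 < R := (norm_nonneg z).trans_lt hzR
  have hsub : Metric.closedBall (0 : ℂ) R ⊆ Metric.ball 0 1 := Metric.closedBall_subset_ball hR
  lift R to NNReal using hR0.le
  have hps := (hd.mono hsub).hasFPowerSeriesOnBall (by exact_mod_cast hR0)
  have hs := hps.hasSum (y := z) (by simpa [← NNReal.coe_lt_coe] using hzR)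
  rw [zero_add] at hs
  suffices hterm : ∀ n : ℕ, (∫ ξ : Circle, (ξ : ℂ) ^ (-n : ℤ) * l ξ ∂circleMeasure) * z ^ n =
      cauchyPowerSeries h 0 R n fun _ => z by
    simpa only [hterm] using hs
  intro n
  have hcont : ContinuousOn (fun w => z ^ n * (w ^ (-n : ℤ) * h w)) (Metric.sphere 0 R) :=
    continuousOn_const.mul (continuousOn_zpow_mul ((hd.continuousOn.mono hsub).mono
      Metric.sphere_subset_closedBall) (fun w hw => Metric.ne_of_mem_sphere hw hR0.ne') _)
  have hint := circleIntegral_inv_mul_eq hR0 hcont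
  have e : ∮ w in C(0, R), (z / (w - 0)) ^ n • (w - 0)⁻¹ • h w =
      ∮ w in C(0, R), w⁻¹ * (z ^ n * (w ^ (-n : ℤ) * h w)) := by
    refine circleIntegral.integral_congr hR0.le fun w hw => ?_
    simp only [sub_zero, smul_eq_mul, zpow_neg, zpow_natCast, div_pow]
    ring
  rw [cauchyPowerSeries_apply, e, hint, smul_eq_mul, inv_mul_cancel_left₀ Complex.two_pi_I_ne_zero,
    integral_zpow_mul_radialLimit hd hb hl _ hR0 hR, integral_const_mul, mul_comm,
    ← integral_const_mul]
  simp only [mul_zpow, mul_assoc]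

lemma isContracting_of_tendsto_moment {g : ℕ → ℂ → ℂ}
    (hG : ∀ n, IsInner (composition g n))
    (h : ∀ (k : ℤ) (j : ℕ), j ≠ 0 → Tendsto (fun n => ∫ ξ : Circle,
      (ξ : ℂ) ^ k * (boundaryMap (composition g n) ξ : ℂ) ^ j ∂circleMeasure) atTop (𝓝 0)) :
    IsContracting g := by
  intro K hK hKsub
  obtain ⟨r, ⟨hr0, hr1⟩, hKr⟩ := exists_pos_lt_subset_ball one_pos hK.isClosed hKsub
  have hcoef_le : ∀ n k, ‖∫ ξ : Circle, (ξ : ℂ) ^ (k : ℤ) * boundaryMap (composition g n) ξ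
      ∂circleMeasure‖ ≤ 1 := by
    intro n k
    refine (norm_integral_le_of_norm_le_const (C := 1) (ae_of_all _ fun ξ => ?_)).trans ?_
    · rw [norm_mul, norm_circle_zpow, Circle.norm_coe, one_mul]
    · simp
  -- the Taylor coefficients are bounded by one, so their decay is uniform on `‖z‖ ≤ r`
  have hlim : Tendsto (fun n => ∑' k : ℕ, ‖∫ ξ : Circle,
      (ξ : ℂ) ^ (-k : ℤ) * boundaryMap (composition g n) ξ ∂circleMeasure‖ * r ^ k)
      atTop (𝓝 (∑' _ : ℕ, 0)) := by
    refine tendsto_tsum_of_dominated_convergence (bound := fun k => r ^ k)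
      (summable_geometric_of_lt_one hr0.le hr1) (fun k => ?_) (Eventually.of_forall fun n k => ?_)
    · have := (h (-k) 1 one_ne_zero).norm.mul_const (r ^ k)
      simpa using this
    · rw [norm_mul, norm_norm, norm_pow, Real.norm_of_nonneg hr0.le]
      exact mul_le_of_le_one_left (by positivity) (hcoef_le n _)
  rw [tsum_zero] at hlim
  refine Metric.tendstoUniformlyOn_iff.2 fun ε hε => ?_
  filter_upwards [hlim.eventually_lt_const hε] with n hn z hz
  have hzr : ‖z‖ < r := by simpa using hKr hz
  rw [dist_zero_left]
  refine lt_of_le_of_lt ?_ hn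
  rw [← (hasSum_moment_mul_pow (hG n).differentiableOn (hG n).norm_le_one
    (hasRadialLimit_boundaryMap (hG n)) (hzr.trans hr1)).tsum_eq]
  refine tsum_of_norm_bounded (Summable.hasSum ?_) fun k => ?_
  · refine Summable.of_nonneg_of_le (fun k => by positivity) (fun k => ?_)
      (summable_geometric_of_lt_one hr0.le hr1)
    exact mul_le_of_le_one_left (by positivity) (hcoef_le n _)
  · rw [norm_mul, norm_pow]
    gcongr

lemma IsContracting.tendsto_moment {g : ℕ → ℂ → ℂ} (h : IsContracting g)
    (hG : ∀ n, IsInner (composition g n)) :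
    ∀ (k : ℤ) (j : ℕ), j ≠ 0 → Tendsto (fun n => ∫ ξ : Circle,
      (ξ : ℂ) ^ k * (boundaryMap (composition g n) ξ : ℂ) ^ j ∂circleMeasure) atTop (𝓝 0) := by
  intro k j hj
  have hsub : Metric.closedBall (0 : ℂ) (1 / 2) ⊆ Metric.ball 0 1 :=
    Metric.closedBall_subset_ball (by norm_num)
  have hunif := Metric.tendstoUniformlyOn_iff.1 (h _ (isCompact_closedBall 0 (1 / 2)) hsub)
  have hj1 : ∀ n, DifferentiableOn ℂ (fun z => composition g n z ^ j) (Metric.ball 0 1) :=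
    fun n => (hG n).differentiableOn.pow j
  have heq : ∀ n, ∫ ξ : Circle, (ξ : ℂ) ^ k * (boundaryMap (composition g n) ξ : ℂ) ^ j
      ∂circleMeasure = ((1 / 2 : ℝ) : ℂ) ^ k *
        ∫ ξ : Circle, (ξ : ℂ) ^ k * composition g n ((1 / 2 : ℝ) * ξ) ^ j ∂circleMeasure :=
    fun n => integral_zpow_mul_radialLimit (hj1 n)
      (fun z hz => by
        rw [norm_pow]
        exact pow_le_one₀ (norm_nonneg _) ((hG n).norm_le_one z hz))
      ((hasRadialLimit_boundaryMap (hG n)).mono fun ξ hξ => hξ.pow j) k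
      (by norm_num) (by norm_num)
  simp_rw [heq]
  rw [← mul_zero (((1 / 2 : ℝ) : ℂ) ^ k)]
  refine Tendsto.const_mul _ (Metric.tendsto_nhds.2 fun ε hε => ?_)
  -- a bound by one makes the `j`-th power at most the first power
  filter_upwards [hunif (min (ε / 2) 1) (by positivity)] with n hn
  rw [dist_zero_right]
  refine lt_of_le_of_lt (norm_integral_le_of_norm_le_const (C := ε / 2)
    (ae_of_all _ fun ξ => ?_)) ?_
  · have hm : ((1 / 2 : ℝ) * ξ : ℂ) ∈ Metric.closedBall (0 : ℂ) (1 / 2) := by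
      rw [mem_closedBall_zero_iff, norm_mul, Circle.norm_coe, mul_one, Complex.norm_real]
      norm_num
    have h1 := hn _ hm
    rw [dist_zero_left] at h1
    rw [norm_mul, norm_circle_zpow, one_mul, norm_pow]
    calc ‖composition g n ((1 / 2 : ℝ) * ξ)‖ ^ j
        ≤ ‖composition g n ((1 / 2 : ℝ) * ξ)‖ :=
          pow_le_of_le_one (norm_nonneg _) (h1.le.trans (min_le_right _ _)) hj
      _ ≤ ε / 2 := h1.le.trans (min_le_left _ _)
  · simpa using hε

end InnerDynamics

theorem mainTheorem3 (g : ℕ → ℂ → ℂ)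
    (hg : ∀ n : ℕ, 1 ≤ n → InnerDynamics.IsInner (g n))
    (hg0 : ∀ n : ℕ, 1 ≤ n → g n 0 = 0) :
    InnerDynamics.IsMixingUsual InnerDynamics.circleMeasure
        (fun n => InnerDynamics.boundaryMap (InnerDynamics.composition g n)) ↔
      InnerDynamics.IsContracting g := by
  have hG := InnerDynamics.isInner_composition hg hg0
  have hG0 := InnerDynamics.composition_zero_eq hg0
  rw [InnerDynamics.isMixingUsual_circle_iff
    (fun n => InnerDynamics.aemeasurable_boundaryMap (hG n))
    fun n => InnerDynamics.map_boundaryMap (hG n) (hG0 n)]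
  exact ⟨InnerDynamics.isContracting_of_tendsto_moment hG, fun h => h.tendsto_moment hG⟩
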